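/- **Theorem.** Let $X$ and $Z$ be topological manifolds (Hausdorff, second countable, locally Euclidean), let $f\colon X\to Z$ be a completed covering, and let $(Y,p,q)$ be a monodromy representation of $f$. Then $f\colon X\to Z$, $p\colon Y\to X$ and $q\colon Y\to Z$ are discrete maps, i.e. all their fibres are discrete subsets of the respective domains. The terms are defined as follows. * A *covering* is a covering map between path-connected spaces. A subset $S$ of a space $T$ is *large* if it is open and dense and $T\setminus S$ does not locally separate $T$, i.e. $U\cap S$ is connected for every connected open $U\subset T$. * A map $g\colon Y\to Z$ between locally connected Hausdorff spaces is a *spread* if the connected components of the sets $g^{-1}(W)$, $W\subset Z$ open, form a basis of the topology of $Y$. For $z\in Z$ let $\mathcal N_Z(z)$ be the set of open connected neighbourhoods of $z$. A *selection function* of $g$ at $z$ assigns to each $W\in\mathcal N_Z(z)$ a component $\Theta(W)$ of $g^{-1}(W)$ such that $\Theta(W_1)\subset\Theta(W_2)$ whenever $W_1\subset W_2$. The spread $g$ is *complete* if $\bigcap_{W\in\mathcal N_Z(z)}\Theta(W)\neq\emptyset$ for all $z\in Z$ and all selection functions $\Theta$ of $g$ at $z$. A complete spread $g\colon Y\to Z$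 is a *completion* of a spread $h\colon Y_0\to Z$ if there is an embedding $i\colon Y_0\to Y$ with large image and $g\circ i=h$. * A map $f\colon Y\to Z$ from a Hausdorff space to a manifold is a *completed covering* if there are large subsets $Y'\subset Y$ and $Z'\subset Z$ such that $f$ restricts to a covering $Y'\to Z'$ and $f$ is a completion of $f|_{Y'}\colon Y'\to Z$. * If a map $f\colon X\to Z$ restricts to a covering $g\colon X'\to Z'$ between large subsets $X'\subset X$, $Z'\subset Z$, and $z_0\in Z'$, the *monodromy group* of $f$ is $\pi_1(Z',z_0)/\ker\sigma_g$, where $\sigma_g\colon\pi_1(Z',z_0)\to\mathrm{Sym}(g^{-1}(z_0))$ is the monodromy of $g$, given by $[\alpha]\mapsto(k\mapsto\text{endpoint of the lift of }\alpha\text{ starting at }k)$; for a completed covering between manifolds its isomorphism class does not depend on the choices. * A *monodromy representation* of a completed covering $f\colon X\to Z$ between manifolds is a triple $(Y,p,q)$, where $Y$ is a locally connected Hausdorff space on which the monodromy group $G$ of $f$ acts by homeomorphisms, such that for some subgroup $H\le G$ and some homeomorphisms $Y/G\approx Z$ and $Y/H\approx X$ the associated orbit maps $q\colon Y\to Y/G\approx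 Z$ and $p\colon Y\to Y/H\approx X$ are completed coverings with $q=f\circ p$. -/

import Mathlib

open Set Topology

universe u v w

/-- `C` is a (nonempty) connected component of the subset `A`. -/
def IsComponentOf {Y : Type u} [TopologicalSpace Y] (C A : Set Y) : Prop :=
  ∃ y ∈ A, C = connectedComponentIn A y

/-- The open connected neighbourhoods of a point `z`. -/
def openConnectedNhds {Z : Type u} [TopologicalSpace Z] (z : Z) : Set (Set Z) :=
  {W | IsOpen W ∧ IsConnected W ∧ z ∈ W}

/-- `A` does not locally separate the ambient space: removing `A` from a connected open set
leaves a connected set. -/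
def DoesNotLocallySeparate {Z : Type u} [TopologicalSpace Z] (A : Set Z) : Prop :=
  ∀ U : Set Z, IsOpen U → IsConnected U → IsConnected (U \ A)

/-- A large subset: open, dense, with complement that does not locally separate the space. -/
structure IsLarge {Z : Type u} [TopologicalSpace Z] (S : Set Z) : Prop where
  isOpen : IsOpen S
  dense : Dense S
  not_locally_separate : DoesNotLocallySeparate Sᶜ

/-- A spread: a map between locally connected Hausdorff spaces for which the components of the
preimages of open sets form a basis of the topology of the domain. -/
structure IsSpread {Y : Type u} {Z : Type v} [TopologicalSpace Y] [TopologicalSpace Z]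
    (g : Y → Z) : Prop where
  t2_source : T2Space Y
  t2_target : T2Space Z
  locallyConnected_source : LocallyConnectedSpace Y
  locallyConnected_target : LocallyConnectedSpace Z
  isTopologicalBasis :
    TopologicalSpace.IsTopologicalBasis {C : Set Y | ∃ W : Set Z, IsOpen W ∧ IsComponentOf C (g ⁻¹' W)}

/-- A selection function of `g` at `z`: a monotone choice of a component of `g ⁻¹' W` for every
open connected neighbourhood `W` of `z` (the values of `Θ` at other sets are irrelevant). -/
structure IsSelectionFunction {Y : Type u} {Z : Type v} [TopologicalSpace Y] [TopologicalSpace Z]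
    (g : Y → Z) (z : Z) (Θ : Set Z → Set Y) : Prop where
  isComponentOf : ∀ W ∈ openConnectedNhds z, IsComponentOf (Θ W) (g ⁻¹' W)
  mono : ∀ W₁ ∈ openConnectedNhds z, ∀ W₂ ∈ openConnectedNhds z, W₁ ⊆ W₂ → Θ W₁ ⊆ Θ W₂

/-- A complete spread: every selection function at every point has nonempty intersection. -/
structure IsCompleteSpread {Y : Type u} {Z : Type v} [TopologicalSpace Y] [TopologicalSpace Z]
    (g : Y → Z) : Prop where
  isSpread : IsSpread g
  complete : ∀ (z : Z) (Θ : Set Z → Set Y), IsSelectionFunction g z Θ →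
    (⋂ W ∈ openConnectedNhds z, Θ W).Nonempty

/-- The complete spread `g` is a completion of the spread `f`. -/
structure IsCompletionOf {X : Type u} {Y : Type v} {Z : Type w} [TopologicalSpace X]
    [TopologicalSpace Y] [TopologicalSpace Z] (g : Y → Z) (f : X → Z) : Prop where
  isSpread : IsSpread f
  isCompleteSpread : IsCompleteSpread g
  exists_embedding : ∃ i : X → Y, IsEmbedding i ∧ IsLarge (range i) ∧ g ∘ i = f

/-- A covering: a covering map between path-connected (in particular nonempty) spaces. -/
structure IsCovering {X : Type u} {Y : Type v} [TopologicalSpace X] [TopologicalSpace Y]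
    (g : X → Y) : Prop where
  pathConnected_source : PathConnectedSpace X
  pathConnected_target : PathConnectedSpace Y
  isCoveringMap : IsCoveringMap g

/-- The subsets `Y'` and `Z'` are large, `f` maps `Y'` into `Z'`, and the restriction
`f : Y' → Z'` is a covering. -/
structure RestrictsToCovering {Y : Type u} {Z : Type v} [TopologicalSpace Y] [TopologicalSpace Z]
    (f : Y → Z) (Y' : Set Y) (Z' : Set Z) : Prop where
  isLarge_source : IsLarge Y'
  isLarge_target : IsLarge Z'
  mapsTo : MapsTo f Y' Z'
  isCovering : IsCovering (mapsTo.restrict f Y' Z')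

/-- A completed covering `f : Y → Z`: for some large subsets `Y'` and `Z'`, the restriction
`Y' → Z'` of `f` is a covering, and `f` is the completion of `Y' → Z`. -/
def IsCompletedCovering {Y : Type u} {Z : Type v} [TopologicalSpace Y] [TopologicalSpace Z]
    (f : Y → Z) : Prop :=
  ∃ (Y' : Set Y) (Z' : Set Z), RestrictsToCovering f Y' Z' ∧
    IsCompletionOf f (fun y : Y' => f y)

/-- The monodromy group `π₁(Z', z₀) / ker σ` of the covering `f : X' → Z'`, where
`σ : π₁(Z', z₀) → Sym (f⁻¹ z₀)` is the monodromy. If the restriction of `f` to large subsets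
is a covering, this is the monodromy group of `f`; up to isomorphism it does not depend on
`X'`, `Z'` and `z₀`. -/
abbrev MonodromyGroup {X : Type u} {Z : Type v} [TopologicalSpace X] [TopologicalSpace Z]
    {f : X → Z} {X' : Set X} {Z' : Set Z} (h : RestrictsToCovering f X' Z') (z₀ : Z') : Type v :=
  FundamentalGroup Z' z₀ ⧸ (h.isCovering.isCoveringMap.monodromyPerm z₀).ker

/-- `p : Y → Z` is the orbit map of the action of `G` on `Y` under some identification of `Z`
with the orbit space: there is a homeomorphism `φ : Y/G → Z` with `p = φ ∘ π`. -/
def IsOrbitMapOf (G : Type u) [Group G] {Y : Type v} {Z : Type w} [TopologicalSpace Y]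
    [TopologicalSpace Z] [MulAction G Y] (p : Y → Z) : Prop :=
  ∃ φ : Quotient (MulAction.orbitRel G Y) ≃ₜ Z, ∀ y : Y, p y = φ (Quotient.mk _ y)

/-- `(Y, p, q)` is a monodromy representation of `f : X → Z`: the space `Y` is Hausdorff and locally
connected, the monodromy group `G` of `f` acts on `Y` by homeomorphisms, `q` is an orbit map of
`G`, `p` is an orbit map of some subgroup `H` of `G`, both are completed coverings, and
`q = f ∘ p`. -/
def IsMonodromyRepresentation {X : Type u} {Y : Type v} {Z : Type w} [TopologicalSpace X]
    [TopologicalSpace Y] [TopologicalSpace Z] (f : X → Z) (p : Y → X) (q : Y → Z) : Prop :=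
  T2Space Y ∧ LocallyConnectedSpace Y ∧
    IsCompletedCovering p ∧ IsCompletedCovering q ∧ q = f ∘ p ∧
    ∃ (X' : Set X) (Z' : Set Z) (h : RestrictsToCovering f X' Z') (z₀ : Z')
      (_ : MulAction (MonodromyGroup h z₀) Y) (_ : ContinuousConstSMul (MonodromyGroup h z₀) Y)
      (H : Subgroup (MonodromyGroup h z₀)),
      IsOrbitMapOf (MonodromyGroup h z₀) q ∧ IsOrbitMapOf H p

/-- A discrete map: every fibre is a discrete subset of the domain. -/
def IsDiscreteMap {X : Type u} {Z : Type v} [TopologicalSpace X] (f : X → Z) : Prop :=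
  ∀ z : Z, IsDiscrete (f ⁻¹' {z})

/-! Everything reduces to `q`, whose fibres are the orbits of the monodromy group `G`. An element of
`G` acts as a map over `Z`, so its action on `Y` is determined by where it sends a single point of
the covering part `Y'`, provided the image is again in `Y'`. By Poincaré–Volterra, `Y'` has a
countable dense set that is the full preimage of a countable set, so countably many pairs of points
encode all these actions and the orbits are countable. A countable nonempty fibre of a complete
spread has an isolated point, by a Baire-type diagonal argument in which completeness supplies the
limit point. `G` acts transitively on the fibre by homeomorphisms, so every point of it is isolated.
Finally, fibres of `p` lie in fibres of `f ∘ p`, and the open surjection `p` carries isolating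
neighbourhoods to `X`. -/

/-! ### Covering maps and Poincaré–Volterra -/

/-- Every point of the base of a covering map has a neighbourhood over which the map is injective
on preconnected sets. -/
theorem IsCoveringMap.exists_injOn_of_isPreconnected {E : Type u} {B : Type v}
    [TopologicalSpace E] [TopologicalSpace B] {p : E → B} (hp : IsCoveringMap p) (x : B) :
    ∃ U : Set B, x ∈ U ∧ IsOpen U ∧ ∀ S ⊆ p ⁻¹' U, IsPreconnected S → InjOn p S := by
  obtain ⟨_, U, hxU, hU, -, H, hH⟩ := hp x
  refine ⟨U, hxU, hU, fun S hS hSc a ha b hb hab => ?_⟩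
  have hpre : IsPreconnected ((↑) ⁻¹' S : Set (p ⁻¹' U)) := by
    rw [← IsInducing.subtypeVal.isPreconnected_image, Subtype.image_preimage_coe,
      inter_eq_right.mpr hS]
    exact hSc
  -- The sheet coordinate takes values in a discrete space, so it is constant on `S`.
  have h2 : (H ⟨a, hS ha⟩).2 = (H ⟨b, hS hb⟩).2 :=
    hpre.constant (f := fun x => (H x).2) (by fun_prop) ha hb
  have h1 : (H ⟨a, hS ha⟩).1 = (H ⟨b, hS hb⟩).1 := Subtype.ext (by rw [hH, hH]; exact hab)
  exact congrArg Subtype.val (H.injective (Prod.ext h1 h2))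

/-- The Poincaré–Volterra theorem for covering maps: if the base is second countable and the
total space is connected and locally connected, then preimages of countable sets are countable. -/
theorem IsCoveringMap.countable_preimage {E : Type u} {B : Type v} [TopologicalSpace E]
    [TopologicalSpace B] [ConnectedSpace E] [LocallyConnectedSpace E] [SecondCountableTopology B]
    {p : E → B} (hp : IsCoveringMap p) {Q : Set B} (hQ : Q.Countable) :
    (p ⁻¹' Q).Countable := by
  obtain ⟨D, hDc, hD⟩ := TopologicalSpace.exists_countable_dense B
  obtain ⟨e₀⟩ : Nonempty E := inferInstance
  -- The dense part `D` ensures that overlapping components share a point over `R`; `Q` is the set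
  -- whose preimage is to be counted.
  set R : Set B := D ∪ Q
  have hRc : R.Countable := hDc.union hQ
  have hR : Dense R := hD.mono subset_union_left
  set 𝓑 : Set (Set B) := {b ∈ TopologicalSpace.countableBasis B |
    ∀ S ⊆ p ⁻¹' b, IsPreconnected S → InjOn p S}
  have h𝓑c : 𝓑.Countable := (TopologicalSpace.countable_countableBasis B).mono (sep_subset _ _)
  have h𝓑o : ∀ b ∈ 𝓑, IsOpen b := fun b hb => TopologicalSpace.isOpen_of_mem_countableBasis hb.1
  have h𝓑 : ∀ x, ∃ b ∈ 𝓑, x ∈ b := by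
    intro x
    obtain ⟨U, hxU, hU, hinj⟩ := hp.exists_injOn_of_isPreconnected x
    obtain ⟨b, hb, hxb, hbU⟩ :=
      (TopologicalSpace.isBasis_countableBasis B).exists_subset_of_mem_open hxU hU
    exact ⟨b, ⟨hb, fun S hS => hinj S (hS.trans (preimage_mono hbU))⟩, hxb⟩
  let comp : E → Set B → Set E := fun e b => connectedComponentIn (p ⁻¹' b) e
  have hcomp_open : ∀ e, ∀ b ∈ 𝓑, IsOpen (comp e b) := fun e b hb =>
    ((h𝓑o b hb).preimage hp.continuous).connectedComponentIn
  -- One round of chaining: all points over `R` in small components through points of `A`.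
  -- Countability survives because `p` is injective on each such component.
  let T : Set E → Set E := fun A => ⋃ a ∈ A, ⋃ b ∈ 𝓑, comp a b ∩ p ⁻¹' R
  have hT : ∀ A : Set E, A.Countable → (T A).Countable := by
    intro A hA
    refine hA.biUnion fun a _ => h𝓑c.biUnion fun b hb => ?_
    refine countable_of_injective_of_countable_image (f := p) ?_
      (hRc.mono (image_subset_iff.mpr inter_subset_right))
    exact (hb.2 _ (connectedComponentIn_subset _ _) isPreconnected_connectedComponentIn).mono
      inter_subset_left
  set A : Set E := ⋃ n : ℕ, T^[n] {e₀}
  have hAc : A.Countable := countable_iUnion fun n => by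
    induction n with
    | zero => exact countable_singleton e₀
    | succ n ih => rw [Function.iterate_succ_apply']; exact hT _ ih
  have hstep : ∀ a ∈ A, ∀ b ∈ 𝓑, comp a b ∩ p ⁻¹' R ⊆ A := by
    intro a ha b hb e he
    obtain ⟨n, hn⟩ := mem_iUnion.mp ha
    refine mem_iUnion.mpr ⟨n + 1, ?_⟩
    rw [Function.iterate_succ_apply']
    exact mem_biUnion hn (mem_biUnion hb he)
  set U : Set E := ⋃ a ∈ A, ⋃ b ∈ 𝓑, comp a b
  have hUo : IsOpen U := isOpen_biUnion fun a _ => isOpen_biUnion fun b hb => hcomp_open a b hb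
  have hUc : IsClosed U := by
    refine isClosed_of_closure_subset fun e he => ?_
    obtain ⟨b, hb, heb⟩ := h𝓑 (p e)
    obtain ⟨x, hx, hxU⟩ := mem_closure_iff.mp he _ (hcomp_open e b hb) (mem_connectedComponentIn heb)
    simp only [U, mem_iUnion] at hxU
    obtain ⟨a, ha, b', hb', hx'⟩ := hxU
    have ho : IsOpen (p '' (comp e b ∩ comp a b')) :=
      hp.isOpenMap _ ((hcomp_open e b hb).inter (hcomp_open a b' hb'))
    obtain ⟨_, ⟨y, hy, rfl⟩, hyR⟩ := hR.inter_open_nonempty _ ho ⟨p x, x, ⟨hx, hx'⟩, rfl⟩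
    refine mem_biUnion (hstep a ha b' hb' ⟨hy.2, hyR⟩) (mem_biUnion hb ?_)
    change e ∈ connectedComponentIn _ _
    rw [← connectedComponentIn_eq hy.1]
    exact mem_connectedComponentIn heb
  have hUne : U.Nonempty := by
    obtain ⟨b, hb, heb⟩ := h𝓑 (p e₀)
    exact ⟨e₀, mem_biUnion (mem_iUnion.mpr ⟨0, rfl⟩) (mem_biUnion hb (mem_connectedComponentIn heb))⟩
  have hU : U = univ := IsClopen.eq_univ ⟨hUc, hUo⟩ hUne
  refine hAc.mono fun e he => ?_
  have heU : e ∈ U := hU ▸ mem_univ e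
  simp only [U, mem_iUnion] at heU
  obtain ⟨a, ha, b, hb, heab⟩ := heU
  exact hstep a ha b hb ⟨heab, Or.inr he⟩

/-! ### Complete spreads and their countable fibres -/

/-- In a complete spread, a sequence of points whose components over the connected neighbourhoods
of `z` are eventually constant converges, componentwise, to a point of the fibre over `z`. -/
theorem IsCompleteSpread.exists_forall_eventually_mem {Y : Type u} {Z : Type v}
    [TopologicalSpace Y] [TopologicalSpace Z] {q : Y → Z} (hq : IsCompleteSpread q) {z : Z}
    (x : ℕ → Y) (hx : ∀ n, q (x n) = z)
    (hconst : ∀ W ∈ openConnectedNhds z, ∃ N, ∀ n ≥ N, x n ∈ connectedComponentIn (q ⁻¹' W) (x N)) :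
    ∃ y, q y = z ∧ ∀ W ∈ openConnectedNhds z,
      ∃ N, ∀ n ≥ N, y ∈ connectedComponentIn (q ⁻¹' W) (x n) := by
  have := hq.isSpread.t2_target
  have := hq.isSpread.locallyConnected_target
  -- The eventual component over `W` along the sequence; `hconst` makes it a single component.
  let Θ : Set Z → Set Y := fun W =>
    {y | ∃ N, ∀ n ≥ N, y ∈ connectedComponentIn (q ⁻¹' W) (x n)}
  have hΘ : IsSelectionFunction q z Θ := by
    refine ⟨fun W hW => ?_, fun W₁ _ W₂ _ h y => ?_⟩
    · obtain ⟨N, hN⟩ := hconst W hW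
      refine ⟨x N, by simpa [hx] using hW.2.2, ?_⟩
      ext y
      constructor
      · rintro ⟨M, hM⟩
        rw [connectedComponentIn_eq (hN _ (le_max_left N M))]
        exact hM _ (le_max_right N M)
      · intro hy
        refine ⟨N, fun n hn => ?_⟩
        rwa [← connectedComponentIn_eq (hN n hn)]
    · rintro ⟨N, hN⟩
      exact ⟨N, fun n hn => connectedComponentIn_mono _ (preimage_mono h) (hN n hn)⟩
  obtain ⟨y, hy⟩ := hq.complete z Θ hΘ
  have hy' : ∀ W ∈ openConnectedNhds z,
      ∃ N, ∀ n ≥ N, y ∈ connectedComponentIn (q ⁻¹' W) (x n) := fun W hW => mem_iInter₂.mp hy W hW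
  refine ⟨y, ?_, hy'⟩
  by_contra hne
  obtain ⟨W, ⟨hWo, hzW, hWc⟩, hW⟩ := (LocallyConnectedSpace.open_connected_basis z).mem_iff.mp
    (isOpen_compl_singleton.mem_nhds (Ne.symm hne : z ∈ ({q y} : Set Z)ᶜ))
  obtain ⟨N, hN⟩ := hy' W ⟨hWo, hWc, hzW⟩
  have hyW : y ∈ q ⁻¹' W := connectedComponentIn_subset _ _ (hN N le_rfl)
  exact hW hyW rfl

/-- Spreads are continuous. -/
theorem IsSpread.continuous {Y : Type u} {Z : Type v} [TopologicalSpace Y] [TopologicalSpace Z]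
    {q : Y → Z} (hq : IsSpread q) : Continuous q := by
  refine ⟨fun W hW => isOpen_iff_mem_nhds.mpr fun y hy => ?_⟩
  exact Filter.mem_of_superset ((hq.isTopologicalBasis.isOpen ⟨W, hW, y, hy, rfl⟩).mem_nhds
    (mem_connectedComponentIn hy)) (connectedComponentIn_subset _ _)

/-- Points of a fibre of a spread have arbitrarily small neighbourhoods that are components over
members of a given neighbourhood basis. -/
theorem IsSpread.exists_component_subset {Y : Type u} {Z : Type v}
    [TopologicalSpace Y] [TopologicalSpace Z] {q : Y → Z} (hq : IsSpread q) {y : Y} {O : Set Y}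
    (hO : O ∈ 𝓝 y) :
    ∃ W ∈ 𝓝 (q y), ∀ W' ⊆ W, connectedComponentIn (q ⁻¹' W') y ⊆ O := by
  obtain ⟨C, ⟨W, hW, w, hw, rfl⟩, hyC, hCO⟩ := hq.isTopologicalBasis.mem_nhds_iff.mp hO
  have hyW : y ∈ q ⁻¹' W := connectedComponentIn_subset _ _ hyC
  refine ⟨W, hW.mem_nhds hyW, fun W' hW' => ?_⟩
  rw [connectedComponentIn_eq hyC] at hCO
  exact (connectedComponentIn_mono _ (preimage_mono hW')).trans hCO

/-- A countable nonempty fibre of a complete spread over a first countable space has an isolated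
point. -/
theorem IsCompleteSpread.exists_isolated_of_countable_fiber {Y : Type u} {Z : Type v}
    [TopologicalSpace Y] [TopologicalSpace Z] [FirstCountableTopology Z] {q : Y → Z}
    (hq : IsCompleteSpread q) {z : Z} (hne : (q ⁻¹' {z}).Nonempty)
    (hc : (q ⁻¹' {z}).Countable) :
    ∃ y ∈ q ⁻¹' {z}, ∃ O ∈ 𝓝 y, O ∩ q ⁻¹' {z} ⊆ {y} := by
  have := hq.isSpread.t2_source
  have := hq.isSpread.t2_target
  have := hq.isSpread.locallyConnected_source
  have := hq.isSpread.locallyConnected_target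
  by_contra! hcon
  obtain ⟨s, hs⟩ := hc.exists_eq_range hne
  obtain ⟨W, hW, hWb⟩ := (LocallyConnectedSpace.open_connected_basis z).exists_antitone_subbasis
  have hWm : ∀ k, W k ∈ openConnectedNhds z := fun k => ⟨(hW k).1, (hW k).2.2, (hW k).2.1⟩
  have hWbasis : ∀ V ∈ 𝓝 z, ∃ k, W k ⊆ V := fun V hV => by simpa using hWb.mem_iff.mp hV
  let C : Y → ℕ → Set Y := fun x k => connectedComponentIn (q ⁻¹' W k) x
  -- Diagonal step: with no isolated points, one can move inside the current component off `s n`,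
  -- then shrink the component to exclude `s n`.
  have hstep : ∀ (n : ℕ) (a : (q ⁻¹' {z} : Set Y) × ℕ), ∃ b : (q ⁻¹' {z} : Set Y) × ℕ,
      a.2 < b.2 ∧ (b.1 : Y) ∈ C a.1 a.2 ∧ s n ∉ C b.1 b.2 := by
    rintro n ⟨⟨x, hx⟩, k⟩
    have hxk : x ∈ q ⁻¹' W k := by
      have : q x = z := hx
      simpa [this] using (hW k).2.1
    have hCo : IsOpen (C x k) :=
      ((hW k).1.preimage hq.isSpread.continuous).connectedComponentIn
    have hxC : x ∈ C x k := mem_connectedComponentIn hxk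
    obtain ⟨x', ⟨hx'C, hx'⟩, hx'n⟩ : ∃ x' ∈ C x k ∩ q ⁻¹' {z}, x' ≠ s n := by
      by_cases hxn : x = s n
      · obtain ⟨x', hx', hne'⟩ := not_subset.mp (hcon x hx _ (hCo.mem_nhds hxC))
        exact ⟨x', hx', fun h => hne' (h.trans hxn.symm)⟩
      · exact ⟨x, ⟨hxC, hx⟩, hxn⟩
    obtain ⟨V, hV, hVs⟩ := hq.isSpread.exists_component_subset
      (isOpen_compl_singleton.mem_nhds (hx'n : x' ∈ ({s n} : Set Y)ᶜ))
    rw [show q x' = z from hx'] at hV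
    obtain ⟨l, hl⟩ := hWbasis V hV
    -- `k + 1` keeps the indices strictly increasing; `l` excludes `s n`.
    refine ⟨⟨⟨x', hx'⟩, max (k + 1) l⟩, lt_of_lt_of_le k.lt_succ_self (le_max_left _ _), hx'C, ?_⟩
    intro hmem
    exact hVs _ ((hWb.antitone (le_max_right _ _)).trans hl) hmem rfl
  choose next hlt hmem hnot using hstep
  obtain ⟨x₀, hx₀⟩ := hne
  let σ : ℕ → (q ⁻¹' {z} : Set Y) × ℕ := fun n => Nat.rec (⟨x₀, hx₀⟩, 0) next n
  let x : ℕ → Y := fun n => (σ n).1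
  let k : ℕ → ℕ := fun n => (σ n).2
  have hk : StrictMono k := strictMono_nat_of_lt_succ fun n => hlt n (σ n)
  have hxz : ∀ n, q (x n) = z := fun n => (σ n).1.2
  have hmem' : ∀ N, ∀ n ≥ N, x n ∈ C (x N) (k N) := by
    intro N n hn
    induction n, hn using Nat.le_induction with
    | base => exact mem_connectedComponentIn (by simpa [hxz] using (hW (k N)).2.1)
    | succ n hn ih =>
      have h1 : x (n + 1) ∈ C (x n) (k N) := connectedComponentIn_mono _
        (preimage_mono (hWb.antitone (hk.monotone hn))) (hmem n (σ n))
      change _ ∈ connectedComponentIn _ _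
      rw [connectedComponentIn_eq ih]
      exact h1
  obtain ⟨y, hyz, hy⟩ := hq.exists_forall_eventually_mem x hxz fun V hV => by
    obtain ⟨l, hl⟩ := hWbasis V (hV.1.mem_nhds hV.2.2)
    exact ⟨l, fun n hn => connectedComponentIn_mono _
      (preimage_mono ((hWb.antitone hk.le_apply).trans hl)) (hmem' l n hn)⟩
  -- The limit point is some `s m`, yet it lies in the component chosen at stage `m + 1` to avoid `s
  -- m`.
  obtain ⟨m, rfl⟩ : y ∈ range s := hs ▸ hyz
  obtain ⟨N, hN⟩ := hy _ (hWm (k (m + 1)))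
  have h1 := hN _ (le_max_left N (m + 1))
  rw [← connectedComponentIn_eq (hmem' _ _ (le_max_right N (m + 1)))] at h1
  exact hnot m (σ m) h1

/-! ### Rigidity and countability of orbits -/

/-- A fibre-preserving homeomorphism of a completed covering with a fixed point in the covering part
is the identity. -/
theorem RestrictsToCovering.eq_self_of_fixed_point {Y : Type u} {Z : Type v} [TopologicalSpace Y]
    [TopologicalSpace Z] [T2Space Y] {q : Y → Z} {Y' : Set Y} {Z' : Set Z}
    (h : RestrictsToCovering q Y' Z') {g : Y → Y} (hg : Continuous g) (hqg : ∀ y, q (g y) = q y)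
    {y₀ : Y} (hy₀ : y₀ ∈ Y') (hfix : g y₀ = y₀) (y : Y) : g y = y := by
  have := h.isCovering.pathConnected_source
  let S : Set Y' := {y | g y = y}
  have hSc : IsClosed S :=
    isClosed_eq (hg.comp continuous_subtype_val) continuous_subtype_val
  have hSo : IsOpen S := by
    refine isOpen_iff_mem_nhds.mpr fun y hy => ?_
    obtain ⟨U, hU, hyU, hinj⟩ := h.isCovering.isCoveringMap.isLocalHomeomorph.isLocallyInjective y
    have hV : IsOpen ((↑) '' U : Set Y) :=
      h.isLarge_source.isOpen.isOpenMap_subtype_val U hU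
    have hgV : (fun y : Y' => g y) ⁻¹' ((↑) '' U) ∈ 𝓝 y :=
      (hV.preimage (hg.comp continuous_subtype_val)).mem_nhds ⟨y, hyU, (hy : g y = y).symm⟩
    filter_upwards [hU.mem_nhds hyU, hgV] with v hv hgv
    obtain ⟨w, hw, hwv⟩ := hgv
    have : w = v := hinj hw hv (Subtype.ext ((congrArg q hwv).trans (hqg v)))
    exact hwv.symm.trans (congrArg Subtype.val this)
  have hS : S = univ := IsClopen.eq_univ ⟨hSc, hSo⟩ ⟨⟨y₀, hy₀⟩, hfix⟩
  have hclosed : IsClosed {y | g y = y} := isClosed_eq hg continuous_id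
  have hsub : Y' ⊆ {y | g y = y} := fun y hy => (hS ▸ mem_univ _ : (⟨y, hy⟩ : Y') ∈ S)
  exact (hclosed.closure_subset_iff.mpr hsub) (h.isLarge_source.dense y)

/-- A countable quotient of the acting group acts on a completed covering of a second countable
space, so the orbits are countable. -/
theorem IsCompletedCovering.countable_orbit {Y : Type u} {Z : Type v} {G : Type w}
    [TopologicalSpace Y] [TopologicalSpace Z] [T2Space Y] [SecondCountableTopology Z] [Group G]
    [MulAction G Y] [ContinuousConstSMul G Y] {q : Y → Z} (hq : IsCompletedCovering q)
    (hqG : ∀ (g : G) y, q (g • y) = q y) (y : Y) : (MulAction.orbit G y).Countable := by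
  obtain ⟨Y', Z', h, hcomp⟩ := hq
  have := h.isCovering.pathConnected_source
  have := hcomp.isSpread.locallyConnected_source
  have hcov := h.isCovering.isCoveringMap
  obtain ⟨Q, hQc, hQ⟩ := TopologicalSpace.exists_countable_dense Z'
  let D : Set Y' := h.mapsTo.restrict q Y' Z' ⁻¹' Q
  have hDc : D.Countable := hcov.countable_preimage hQc
  have hD : Dense D := hQ.preimage hcov.isOpenMap
  -- `Y'` need not be `G`-invariant, but density gives a point `d` of `D` with `g • d` in `Y'`. It
  -- then lies in `D`, since `D` is a full preimage under `q` within `Y'`.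
  have key : ∀ g : G, ∃ c : Y' × Y', c ∈ D ×ˢ D ∧ g • (c.1 : Y) = c.2 := by
    intro g
    have hd : Dense ((↑) '' D : Set Y) :=
      h.isLarge_source.dense.denseRange_val.dense_image continuous_subtype_val hD
    have hgo : IsOpen ((g • · : Y → Y) ⁻¹' Y') :=
      h.isLarge_source.isOpen.preimage (continuous_const_smul g)
    obtain ⟨y₁⟩ : Nonempty Y' := inferInstance
    obtain ⟨_, hdY, d, hdD, rfl⟩ := hd.inter_open_nonempty _ hgo
      ⟨g⁻¹ • (y₁ : Y), by simp⟩
    refine ⟨⟨d, ⟨g • (d : Y), hdY⟩⟩, ⟨hdD, ?_⟩, rfl⟩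
    have : h.mapsTo.restrict q Y' Z' ⟨g • (d : Y), hdY⟩ = h.mapsTo.restrict q Y' Z' d :=
      Subtype.ext (hqG g d)
    change _ ∈ Q
    rw [this]
    exact hdD
  choose c hcD hc using key
  -- If `g` and `g'` share a pair, `g⁻¹ * g'` fixes a point of `Y'`, hence acts trivially.
  have hfac : (fun g : G => g • y).FactorsThrough c := by
    intro g g' hgg
    have hfix : (g⁻¹ * g') • ((c g).1 : Y) = (c g).1 := by
      rw [mul_smul, inv_smul_eq_iff, hc g, hgg, hc g']
    have := h.eq_self_of_fixed_point (continuous_const_smul (g⁻¹ * g')) (hqG _) (c g).1.2 hfix y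
    rw [mul_smul, inv_smul_eq_iff] at this
    exact this.symm
  have hrange : (range c).Countable :=
    (hDc.prod hDc).mono (range_subset_iff.mpr hcD)
  refine (hrange.image (Function.extend c (fun g : G => g • y) fun _ => y)).mono ?_
  rintro _ ⟨g, rfl⟩
  exact ⟨c g, ⟨g, rfl⟩, hfac.extend_apply _ g⟩

/-! ### Orbit maps and discreteness -/

theorem IsOrbitMapOf.map_smul {G : Type u} [Group G] {Y : Type v} {Z : Type w} [TopologicalSpace Y]
    [TopologicalSpace Z] [MulAction G Y] {p : Y → Z} (hp : IsOrbitMapOf G p) (g : G) (y : Y) :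
    p (g • y) = p y := by
  obtain ⟨φ, hφ⟩ := hp
  rw [hφ, hφ]
  exact congrArg φ (Quotient.sound ⟨g, rfl⟩)

theorem IsOrbitMapOf.mem_orbit {G : Type u} [Group G] {Y : Type v} {Z : Type w} [TopologicalSpace Y]
    [TopologicalSpace Z] [MulAction G Y] {p : Y → Z} (hp : IsOrbitMapOf G p) {y y' : Y}
    (h : p y = p y') : y ∈ MulAction.orbit G y' := by
  obtain ⟨φ, hφ⟩ := hp
  rw [hφ, hφ] at h
  exact Quotient.exact (φ.injective h)

theorem IsOrbitMapOf.surjective {G : Type u} [Group G] {Y : Type v} {Z : Type w}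
    [TopologicalSpace Y] [TopologicalSpace Z] [MulAction G Y] {p : Y → Z}
    (hp : IsOrbitMapOf G p) : Function.Surjective p := by
  obtain ⟨φ, hφ⟩ := hp
  rw [funext hφ]
  exact φ.surjective.comp Quotient.mk_surjective

theorem IsOrbitMapOf.isOpenMap {G : Type u} [Group G] {Y : Type v} {Z : Type w}
    [TopologicalSpace Y] [TopologicalSpace Z] [MulAction G Y] [ContinuousConstSMul G Y] {p : Y → Z}
    (hp : IsOrbitMapOf G p) : IsOpenMap p := by
  obtain ⟨φ, hφ⟩ := hp
  rw [funext hφ]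
  exact φ.isOpenMap.comp isOpenMap_quotient_mk'_mul

theorem isDiscrete_iff_exists_nhds_inter_subset {Y : Type u} [TopologicalSpace Y] {s : Set Y} :
    IsDiscrete s ↔ ∀ y ∈ s, ∃ O ∈ 𝓝 y, O ∩ s ⊆ {y} := by
  simp_rw [← mem_nhdsWithin_iff_exists_mem_nhds_inter, ← Filter.le_pure_iff]
  exact ⟨fun h y hy => (isDiscrete_iff_nhdsWithin.mp h y hy).le, IsDiscrete.of_nhdsWithin⟩

/-- A completed covering of a second countable space that is an orbit map is discrete. -/
theorem IsCompletedCovering.isDiscreteMap_of_isOrbitMapOf {Y : Type u} {Z : Type v} {G : Type w}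
    [TopologicalSpace Y] [TopologicalSpace Z] [T2Space Y] [SecondCountableTopology Z] [Group G]
    [MulAction G Y] [ContinuousConstSMul G Y] {q : Y → Z} (hq : IsCompletedCovering q)
    (hG : IsOrbitMapOf G q) : IsDiscreteMap q := by
  refine fun z => isDiscrete_iff_exists_nhds_inter_subset.mpr fun y hy => ?_
  have hq' : IsCompleteSpread q := by
    obtain ⟨_, _, _, h⟩ := hq
    exact h.isCompleteSpread
  have hcount : (q ⁻¹' {z}).Countable := (hq.countable_orbit hG.map_smul y).mono
    fun y' hy' => hG.mem_orbit ((hy' : q y' = z).trans (hy : q y = z).symm)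
  obtain ⟨y₁, hy₁, O, hO, hOz⟩ := hq'.exists_isolated_of_countable_fiber ⟨y, hy⟩ hcount
  -- The isolated point is a translate `g • y`; pulling its neighbourhood back along `g` isolates
  -- `y`.
  obtain ⟨g, rfl⟩ := hG.mem_orbit ((hy₁ : q y₁ = z).trans (hy : q y = z).symm)
  refine ⟨(g • · : Y → Y) ⁻¹' O, (continuous_const_smul g).continuousAt hO, fun y' hy' => ?_⟩
  exact MulAction.injective g (hOz ⟨hy'.1, (hG.map_smul g y').trans hy'.2⟩)

/-- If `f ∘ p` is discrete, so is `p`. -/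
theorem IsDiscreteMap.of_comp {X : Type u} {Y : Type v} {Z : Type w} [TopologicalSpace Y]
    {f : X → Z} {p : Y → X} (h : IsDiscreteMap (f ∘ p)) : IsDiscreteMap p := fun x =>
  (h (f x)).mono fun _ hy => congrArg f hy

/-- If `f ∘ p` is discrete and `p` is open and surjective, then `f` is discrete. -/
theorem IsDiscreteMap.of_comp_isOpenMap {X : Type u} {Y : Type v} {Z : Type w}
    [TopologicalSpace X] [TopologicalSpace Y] {f : X → Z} {p : Y → X}
    (h : IsDiscreteMap (f ∘ p)) (hp : IsOpenMap p) (hps : Function.Surjective p) :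
    IsDiscreteMap f := by
  refine fun z => isDiscrete_iff_exists_nhds_inter_subset.mpr fun x hx => ?_
  obtain ⟨y, rfl⟩ := hps x
  obtain ⟨O, hO, hOz⟩ := isDiscrete_iff_exists_nhds_inter_subset.mp (h z) y hx
  refine ⟨p '' O, hp.image_mem_nhds hO, ?_⟩
  rintro _ ⟨⟨y', hy', rfl⟩, hz⟩
  exact congrArg p (hOz ⟨hy', hz⟩)

theorem mainTheorem6 {X : Type u} {Y : Type v} {Z : Type w}
    [TopologicalSpace X] [TopologicalSpace Y] [TopologicalSpace Z]
    (m n : ℕ)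
    [T2Space X] [SecondCountableTopology X] [ChartedSpace (EuclideanSpace ℝ (Fin m)) X]
    [T2Space Z] [SecondCountableTopology Z] [ChartedSpace (EuclideanSpace ℝ (Fin n)) Z]
    (f : X → Z) (hf : IsCompletedCovering f)
    (p : Y → X) (q : Y → Z) (hpq : IsMonodromyRepresentation f p q) :
    IsDiscreteMap f ∧ IsDiscreteMap p ∧ IsDiscreteMap q := by
  obtain ⟨hT2, -, -, hq, rfl, X', Z', h, z₀, hact, hcont, H, hG, hH⟩ := hpq
  have hd : IsDiscreteMap (f ∘ p) := hq.isDiscreteMap_of_isOrbitMapOf hG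
  have hHcont : ContinuousConstSMul H Y := ⟨fun g => hcont.continuous_const_smul g.1⟩
  exact ⟨hd.of_comp_isOpenMap hH.isOpenMap hH.surjective, hd.of_comp, hd⟩
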